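/- Let $\Gamma$ be a countable discrete group. Let $L^2(\Gamma)$ be the Hilbert space of square summable formal series $\sum_{\gamma} x_\gamma\gamma$ with complex coefficients (scalar product $(\cdot,\cdot)$ linear in the first variable), let $\mathbb{C}\Gamma\subset L^2(\Gamma)$ be the group ring, and let $\mathcal{N}\Gamma$ be the von Neumann algebra of all bounded operators on $L^2(\Gamma)$ that commute with left multiplication by every element of $\Gamma$, with trace $\tau(B)=(Be,e)$. The Fuglede--Kadison determinant of $B\in\mathcal{N}\Gamma$ is $$\mathrm{det}_{\mathcal{N}\Gamma}B=\lim_{\varepsilon\to0+}\exp\tau\big(\log(|B|+\varepsilon)\big)\in[0,\infty),\qquad |B|=(B^*B)^{1/2}.$$ An element $f=\sum f_\gamma\gamma$ of $\mathbb{C}\Gamma$ is viewed as the element $r(f)=\sum f_\gamma R_{\gamma^{-1}}$ of $\mathcal{N}\Gamma$, where $R_\gamma(x)=x\gamma$, and one puts $\tilde f=\sum f_\gamma\gamma^{-1}$. For a finite subset $F\subset\Gamma$ let $i_F:\mathbb{C}F\to L^2(\Gamma)$ be the inclusion of the span of $F$, $p_F:L^2(\Gamma)\to\mathbb{C}F$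 the orthogonal projection, and for $A\in\mathcal{N}\Gamma$ let $A_F=p_F A\, i_F$, an endomorphism of $\mathbb{C}F$. Let $A\in\mathcal{N}\Gamma$ be positive, and injective on $\mathbb{C}\Gamma$, and let $F$ and $F'=F\,\dot\cup\,\{\gamma\}$ be finite subsets of $\Gamma$. Put $$\Phi_\gamma=\gamma-i_FA_F^{-1}p_FA\gamma\in\mathbb{C}F',$$ the component of $\gamma$ orthogonal to $\mathbb{C}F$ for the scalar product $(u,v)_A=(Au,v)$ on $\mathbb{C}F'$. Then $\det A_F>0$ (so that $A_F$ is invertible) and $$(\mathrm{det}_{\mathcal{N}\Gamma}A)\,(\mathrm{det}_{\mathcal{N}\Gamma}\tilde\Phi_\gamma)^2\le\frac{\det A_{F'}}{\det A_F}.$$ -/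

import Mathlib

open scoped ComplexOrder Topology

noncomputable section

namespace GroupVN

section Determinant

variable {H : Type*} [NormedAddCommGroup H] [InnerProductSpace ℂ H] [CompleteSpace H]

/-- The Fuglede-Kadison determinant `exp τ(log |A|)` of an invertible operator `A`, for a trace `τ`.
The logarithm is that of the continuous functional calculus; `τ(log |A|)` is real for a positive
`τ`. -/
def fkDetUnit (τ : (H →L[ℂ] H) → ℂ) (A : H →L[ℂ] H) : ℝ :=
  Real.exp (τ (CFC.log (CFC.abs A))).re

/-- The Fuglede-Kadison determinant of an arbitrary operator `A` for a trace `τ`: the limit of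
`det (|A| + ε)` as `ε → 0+`. For the vector state `τ(T) = (T e, e)` the limit always exists, see
`tendsto_fkDetOf`. -/
def fkDetOf (τ : (H →L[ℂ] H) → ℂ) (A : H →L[ℂ] H) : ℝ :=
  Filter.limUnder (𝓝[>] (0 : ℝ)) fun ε => fkDetUnit τ (CFC.abs A + (ε : ℂ) • (1 : H →L[ℂ] H))

theorem fkDetUnit_mono (e : H) (A : H →L[ℂ] H) :
    MonotoneOn (fun ε : ℝ => fkDetUnit (fun T => inner ℂ e (T e))
      (CFC.abs A + (ε : ℂ) • (1 : H →L[ℂ] H))) (Set.Ioi 0) := by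
  have hA : 0 ≤ CFC.abs A := CFC.abs_nonneg A
  have hsa : IsSelfAdjoint (CFC.abs A) := hA.isSelfAdjoint
  have key : ∀ ε : ℝ, 0 < ε →
      CFC.log (CFC.abs (CFC.abs A + (ε : ℂ) • (1 : H →L[ℂ] H))) =
        cfc (fun x : ℝ => Real.log (x + ε)) (CFC.abs A) := by
    intro ε hε
    have h1 : cfc (fun x : ℝ => x + ε) (CFC.abs A) =
        CFC.abs A + (ε : ℂ) • (1 : H →L[ℂ] H) := by
      rw [cfc_add_const ε (fun x : ℝ => x) (CFC.abs A), cfc_id' ℝ (CFC.abs A),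
        Algebra.algebraMap_eq_smul_one, Complex.coe_smul]
    have h2 : 0 ≤ CFC.abs A + (ε : ℂ) • (1 : H →L[ℂ] H) := by
      rw [← h1]
      exact cfc_nonneg fun x hx => by
        have := spectrum_nonneg_of_nonneg hA hx
        positivity
    rw [CFC.abs_of_nonneg _ h2, CFC.log, ← h1]
    refine (cfc_comp' Real.log (fun x : ℝ => x + ε) (CFC.abs A) ?_ ?_).symm
    · rintro y ⟨x, hx, rfl⟩
      have := spectrum_nonneg_of_nonneg hA hx
      exact (Real.continuousAt_log (by positivity)).continuousWithinAt
    · fun_prop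
  have hcont : ∀ ε : ℝ, 0 < ε →
      ContinuousOn (fun x : ℝ => Real.log (x + ε)) (spectrum ℝ (CFC.abs A)) := by
    intro ε hε
    refine ContinuousOn.log (by fun_prop) fun x hx => ?_
    have := spectrum_nonneg_of_nonneg hA hx
    positivity
  intro ε hε ε' hε' h
  simp only [Set.mem_Ioi] at hε hε'
  simp only [fkDetUnit, Real.exp_le_exp, key ε hε, key ε' hε']
  have hle : cfc (fun x : ℝ => Real.log (x + ε)) (CFC.abs A) ≤
      cfc (fun x : ℝ => Real.log (x + ε')) (CFC.abs A) := by
    refine cfc_mono (fun x hx => ?_) (hcont ε hε) (hcont ε' hε')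
    have := spectrum_nonneg_of_nonneg hA hx
    exact Real.log_le_log (by positivity) (by linarith)
  rw [ContinuousLinearMap.le_def] at hle
  have h0 := hle.re_inner_nonneg_right e
  simp only [sub_apply, inner_sub_right, map_sub] at h0
  exact sub_nonneg.1 h0

theorem tendsto_fkDetOf (e : H) (A : H →L[ℂ] H) :
    Filter.Tendsto (fun ε : ℝ => fkDetUnit (fun T => inner ℂ e (T e))
      (CFC.abs A + (ε : ℂ) • (1 : H →L[ℂ] H))) (𝓝[>] (0 : ℝ))
      (𝓝 (fkDetOf (fun T => inner ℂ e (T e)) A)) := by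
  refine tendsto_nhds_limUnder ⟨_, (fkDetUnit_mono e A).tendsto_nhdsGT ⟨0, ?_⟩⟩
  rintro _ ⟨ε, -, rfl⟩
  exact (Real.exp_pos _).le

end Determinant

variable {Γ : Type*}

/-- The Hilbert space `L²(Γ)` of a discrete group `Γ`. -/
abbrev L2 (Γ : Type*) : Type _ := lp (fun _ : Γ => ℂ) 2

/-- The algebra of bounded operators on `L²(Γ)`. -/
abbrev BddOp (Γ : Type*) : Type _ := L2 Γ →L[ℂ] L2 Γ

/-- The inclusion `ℂΓ ⊆ L²(Γ)`: a finite formal sum is viewed as a square summable one. -/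
def toL2 : MonoidAlgebra ℂ Γ →ₗ[ℂ] L2 Γ where
  toFun f := ⟨fun γ => f.coeff γ, by
    refine (memℓp_zero ?_).of_exponent_ge (zero_le)
    exact f.coeff.hasFiniteSupport.subset fun γ hγ => by simpa using hγ⟩
  map_add' f g := by ext γ; rfl
  map_smul' c f := by ext γ; rfl

@[simp] theorem toL2_apply (f : MonoidAlgebra ℂ Γ) (γ : Γ) : toL2 f γ = f.coeff γ := rfl

/-- The group element `γ`, viewed as a vector of `L²(Γ)`. -/
def vec (γ : Γ) : L2 Γ := toL2 (MonoidAlgebra.single γ 1)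

theorem memℓp_comp (σ : Γ ≃ Γ) (x : L2 Γ) :
    Memℓp (fun δ => x (σ δ)) (2 : ENNReal) := by
  have h := lp.memℓp x
  rw [memℓp_gen_iff (by norm_num)] at h ⊢
  exact (σ.summable_iff (f := fun i => ‖x i‖ ^ (2 : ENNReal).toReal)).2 h

/-- The unitary operator of `L²(Γ)` given by a permutation `σ` of `Γ`: it maps
`x` to the function `δ ↦ x (σ δ)`. -/
def perm (σ : Γ ≃ Γ) : BddOp Γ :=
  LinearIsometry.toContinuousLinearMap
    { toFun := fun x => ⟨fun δ => x (σ δ), memℓp_comp σ x⟩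
      map_add' := fun x y => by ext δ; rfl
      map_smul' := fun c x => by ext δ; rfl
      norm_map' := fun x => by
        rw [lp.norm_eq_tsum_rpow (by norm_num), lp.norm_eq_tsum_rpow (by norm_num)]
        congr 1
        exact σ.tsum_eq (fun i => ‖x i‖ ^ (2 : ENNReal).toReal) }

@[simp] theorem perm_apply (σ : Γ ≃ Γ) (x : L2 Γ) (δ : Γ) : perm σ x δ = x (σ δ) := rfl

/-- The inclusion `ℂF ⊆ ℂΓ` for a finite subset `F` of `Γ`. The space `ℂF` is modelled as `ℂ^F`
with its standard scalar product, for which `F` is an orthonormal basis. -/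
def incl (F : Finset Γ) : EuclideanSpace ℂ F →ₗ[ℂ] MonoidAlgebra ℂ Γ where
  toFun v := ∑ δ : F, MonoidAlgebra.single (δ : Γ) (v δ)
  map_add' v w := by simp [MonoidAlgebra.single_add, Finset.sum_add_distrib]
  map_smul' c v := by simp [Finset.smul_sum, MonoidAlgebra.smul_single]

/-- The inclusion `i_F : ℂF → L²(Γ)`. -/
def inclL2 (F : Finset Γ) : EuclideanSpace ℂ F →L[ℂ] L2 Γ :=
  LinearMap.toContinuousLinearMap (toL2 ∘ₗ incl F)

/-- The orthogonal projection `p_F : L²(Γ) → ℂF`, i.e. the adjoint of `i_F`. -/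
def proj (F : Finset Γ) : L2 Γ →L[ℂ] EuclideanSpace ℂ F :=
  ContinuousLinearMap.adjoint (inclL2 F)

theorem inclL2_apply (F : Finset Γ) (v : EuclideanSpace ℂ F) (δ : F) :
    inclL2 F v (δ : Γ) = v δ := by
  classical
  change (incl F v).coeff (δ : Γ) = v δ
  simp [incl, MonoidAlgebra.coeff_sum, MonoidAlgebra.coeff_single, Finsupp.single_apply,
    Finsupp.finsetSum_apply]

theorem inclL2_single [DecidableEq Γ] (F : Finset Γ) (δ : F) :
    inclL2 F (EuclideanSpace.single δ 1) = vec (δ : Γ) := by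
  change toL2 (incl F (EuclideanSpace.single δ 1)) = toL2 _
  congr 1
  change ∑ ε : F, MonoidAlgebra.single (ε : Γ) (EuclideanSpace.single δ (1 : ℂ) ε) = _
  rw [Finset.sum_eq_single δ] <;> simp +contextual

theorem inner_vec (γ : Γ) (x : L2 Γ) : inner ℂ (vec γ) x = x γ := by
  classical
  have h : vec γ = lp.single 2 γ (1 : ℂ) := by
    ext δ
    simp [vec, MonoidAlgebra.coeff_single, Finsupp.single_apply, Pi.single_apply, eq_comm]
  rw [h, lp.inner_single_left]
  simp

theorem proj_apply (F : Finset Γ) (x : L2 Γ) (δ : F) : proj F x δ = x (δ : Γ) := by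
  classical
  rw [← inner_vec, ← inclL2_single, ← ContinuousLinearMap.adjoint_inner_right]
  simp [proj, EuclideanSpace.inner_single_left]

/-- The endomorphism `A_F = p_F ∘ A ∘ i_F` of `ℂF`. -/
def compress (A : BddOp Γ) (F : Finset Γ) : EuclideanSpace ℂ F →L[ℂ] EuclideanSpace ℂ F :=
  proj F ∘L A ∘L inclL2 F

/-- The vector `ψ(γ) = i_F A_F⁻¹ p_F A γ` of `ℂF ⊆ ℂΓ`. When `A` is positive and injective on
`ℂΓ`, it is the orthogonal projection of `γ` to `ℂF` for the scalar product `(u, v)_A = (A u, v)`.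
-/
def psi (A : BddOp Γ) (F : Finset Γ) (γ : Γ) : MonoidAlgebra ℂ Γ :=
  incl F (Ring.inverse (compress A F) (proj F (A (vec γ))))

/-- The residual `Φ_γ = γ - ψ(γ)`, an element of `ℂΓ`. -/
def orthResidual (A : BddOp Γ) (F : Finset Γ) (γ : Γ) : MonoidAlgebra ℂ Γ :=
  MonoidAlgebra.single γ 1 - psi A F γ

/-- If `A_F` is invertible, `Φ_γ` is orthogonal to `ℂF` for `(u, v)_A = (A u, v)`. -/
theorem orthResidual_orthogonal (A : BddOp Γ) (F : Finset Γ) (γ : Γ) (h : IsUnit (compress A F))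
    (v : EuclideanSpace ℂ F) :
    inner ℂ (inclL2 F v) (A (toL2 (orthResidual A F γ))) = 0 := by
  have h1 : toL2 (orthResidual A F γ) =
      vec γ - inclL2 F (Ring.inverse (compress A F) (proj F (A (vec γ)))) := by
    rw [orthResidual, map_sub]; rfl
  have h2 : proj F (A (toL2 (orthResidual A F γ))) = 0 := by
    have h3 := congrArg (fun T : EuclideanSpace ℂ F →L[ℂ] EuclideanSpace ℂ F =>
      T (proj F (A (vec γ)))) (Ring.mul_inverse_cancel _ h)
    rw [h1, map_sub, map_sub, sub_eq_zero]
    exact h3.symm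
  rw [← ContinuousLinearMap.adjoint_inner_right]
  change inner ℂ v (proj F _) = 0
  rw [h2, inner_zero_right]

variable [Group Γ]

/-- Left translation `x ↦ γ x` on `L²(Γ)`. -/
def leftMul (γ : Γ) : BddOp Γ := perm (Equiv.mulLeft γ⁻¹)

/-- The operator `R_γ`, that is, right translation `x ↦ x γ` on `L²(Γ)`. -/
def rightMul (γ : Γ) : BddOp Γ := perm (Equiv.mulRight γ⁻¹)

@[simp] theorem leftMul_apply (γ δ : Γ) (x : L2 Γ) : leftMul γ x δ = x (γ⁻¹ * δ) := rfl

@[simp] theorem rightMul_apply (γ δ : Γ) (x : L2 Γ) : rightMul γ x δ = x (δ * γ⁻¹) := rfl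

theorem leftMul_vec (γ δ : Γ) : leftMul γ (vec δ) = vec (γ * δ) := by
  ext ε
  classical
  simp [vec, MonoidAlgebra.coeff_single, Finsupp.single_apply, eq_inv_mul_iff_mul_eq]

theorem rightMul_vec (γ δ : Γ) : rightMul γ (vec δ) = vec (δ * γ) := by
  ext ε
  classical
  simp [vec, MonoidAlgebra.coeff_single, Finsupp.single_apply, eq_mul_inv_iff_mul_eq]

theorem star_leftMul (γ : Γ) : star (leftMul γ) = leftMul γ⁻¹ := by
  rw [ContinuousLinearMap.star_eq_adjoint, eq_comm, ContinuousLinearMap.eq_adjoint_iff]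
  intro x y
  rw [lp.inner_eq_tsum, lp.inner_eq_tsum, ← (Equiv.mulLeft γ⁻¹).tsum_eq]
  simp

/-- The von Neumann algebra `𝒩Γ` of `Γ`: the bounded operators on `L²(Γ)` that commute with all
left translations. -/
def vonNeumann (Γ : Type*) [Group Γ] : VonNeumannAlgebra (L2 Γ) where
  toStarSubalgebra := StarSubalgebra.centralizer ℂ (Set.range (leftMul : Γ → BddOp Γ))
  centralizer_centralizer' := by
    change Set.centralizer (Set.centralizer
      (StarSubalgebra.centralizer ℂ (Set.range (leftMul : Γ → BddOp Γ)) : Set (BddOp Γ))) =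
      (StarSubalgebra.centralizer ℂ (Set.range (leftMul : Γ → BddOp Γ)) : Set (BddOp Γ))
    rw [StarSubalgebra.coe_centralizer, Set.centralizer_centralizer_centralizer]

theorem mem_vonNeumann_iff {A : BddOp Γ} :
    A ∈ vonNeumann Γ ↔ ∀ (γ : Γ) (x : L2 Γ), A (leftMul γ x) = leftMul γ (A x) := by
  change A ∈ (StarSubalgebra.centralizer ℂ (Set.range (leftMul : Γ → BddOp Γ))) ↔ _
  rw [StarSubalgebra.mem_centralizer_iff]
  constructor
  · intro h γ x
    exact (congrArg (fun T : BddOp Γ => T x) (h _ ⟨γ, rfl⟩).1).symm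
  · rintro h _ ⟨γ, rfl⟩
    rw [star_leftMul]
    exact ⟨ContinuousLinearMap.ext fun x => (h γ x).symm,
      ContinuousLinearMap.ext fun x => (h γ⁻¹ x).symm⟩

/-- The algebra homomorphism `r : ℂΓ → 𝒩Γ`, `r (∑ f_γ γ) = ∑ f_γ R_{γ⁻¹}`
(its values lie in `𝒩Γ` by `rightReg_mem`). -/
def rightReg : MonoidAlgebra ℂ Γ →ₐ[ℂ] BddOp Γ :=
  MonoidAlgebra.lift ℂ (BddOp Γ) Γ
    { toFun := fun γ => rightMul γ⁻¹
      map_one' := by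
        ext x δ
        simp
      map_mul' := fun γ γ' => by
        ext x δ
        simp [mul_assoc] }

theorem rightReg_single (γ : Γ) (c : ℂ) :
    rightReg (MonoidAlgebra.single γ c) = c • rightMul γ⁻¹ := by
  simp [rightReg, MonoidAlgebra.lift_single]

theorem rightReg_mem (f : MonoidAlgebra ℂ Γ) : rightReg f ∈ vonNeumann Γ := by
  induction f using MonoidAlgebra.induction_linear with
  | zero => rw [map_zero]; exact zero_mem _
  | add f g hf hg => rw [map_add]; exact add_mem hf hg
  | single γ c =>
    rw [rightReg_single, mem_vonNeumann_iff]
    intro γ' x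
    ext δ
    simp [mul_assoc]

/-- The involution `f = ∑ f_γ γ ↦ f̃ = ∑ f_γ γ⁻¹` of `ℂΓ` (no complex conjugation). -/
def tilde (f : MonoidAlgebra ℂ Γ) : MonoidAlgebra ℂ Γ :=
  MonoidAlgebra.mapDomain (fun γ => γ⁻¹) f

/-- The canonical trace `τ(A) = (A e, e)`. Mathlib's inner product is linear in the second
variable. -/
def trace (A : BddOp Γ) : ℂ := inner ℂ (vec (1 : Γ)) (A (vec 1))

/-- The Fuglede-Kadison determinant `det_{𝒩Γ}` of an operator in `𝒩Γ`. -/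
def fkDet (A : BddOp Γ) : ℝ := fkDetOf trace A

end GroupVN

end

open GroupVN

noncomputable section

namespace GroupVN

/-! ### Functional calculus for the regularised modulus `|T| + ε`. -/

section FunctionalCalculus

variable {H : Type*} [NormedAddCommGroup H] [InnerProductSpace ℂ H] [CompleteSpace H]

/-! Both sides are compared with `(AΦ, Φ)`, where `Φ = Φ_γ`. On the matrix side it is the Schur
complement of `A_F` in `A_{F'}`, hence the quotient of determinants (`det_compress_cons`). On the
operator side `T = r(Φ̃)` satisfies `T e = Φ`, so `(AΦ, Φ) = τ(T* A T)`, and it remains to show `det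
A · (det T)² ≤ τ(T* A T)` (`fkDetOf_mul_fkDetOf_sq_le`).

Since `det T = det T*` (`fkDetOf_star`) and `τ(T* A T) = τ(A |T*|²)`, taking `X = log(A + ε)` and `Y
= 2 log(|T*| + ε)` reduces this to `exp(τ(X) + τ(Y)) ≤ τ(e^X e^Y)` for self-adjoint `X`, `Y`,
followed by `ε → 0`. That inequality (`exp_trace_le_trace_exp_mul_exp`) uses only positivity and
traciality of `τ`: a doubling estimate for `g(t) = τ(e^{tX} e^{tY})` bounds `g(1) - 1` below by
`g'(0) = τ(X) + τ(Y)`, and a scalar shift of `Y` upgrades the linear bound to the exponential one.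
-/

theorem abs_eq_cfc_sqrt (T : H →L[ℂ] H) : CFC.abs T = cfc Real.sqrt (star T * T) := by
  rw [CFC.abs, CFC.sqrt_eq_real_sqrt _ (star_mul_self_nonneg T), cfcₙ_eq_cfc]

theorem abs_add_smul_one_eq_cfc (T : H →L[ℂ] H) (ε : ℝ) :
    CFC.abs T + (ε : ℂ) • (1 : H →L[ℂ] H) = cfc (fun x => √x + ε) (star T * T) := by
  rw [cfc_add_const ε Real.sqrt (star T * T), ← abs_eq_cfc_sqrt,
    Algebra.algebraMap_eq_smul_one, Complex.coe_smul]

theorem continuous_log_sqrt_add {ε : ℝ} (hε : 0 < ε) :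
    Continuous fun x : ℝ => Real.log (√x + ε) :=
  Continuous.log (by fun_prop) fun x => by positivity

/-- Written as a function of `T*T` rather than of `|T|`, the logarithm can be compared with its
counterpart for `TT*`. -/
theorem log_abs_add_smul_one (T : H →L[ℂ] H) {ε : ℝ} (hε : 0 < ε) :
    CFC.log (CFC.abs (CFC.abs T + (ε : ℂ) • (1 : H →L[ℂ] H))) =
      cfc (fun x => Real.log (√x + ε)) (star T * T) := by
  have h2 : 0 ≤ CFC.abs T + (ε : ℂ) • (1 : H →L[ℂ] H) := by
    rw [abs_add_smul_one_eq_cfc]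
    exact cfc_nonneg fun x _ => by positivity
  rw [CFC.abs_of_nonneg _ h2, CFC.log, abs_add_smul_one_eq_cfc]
  refine (cfc_comp' Real.log (fun x : ℝ => √x + ε) (star T * T) ?_ ?_).symm
  · rintro y ⟨x, -, rfl⟩
    exact (Real.continuousAt_log (by positivity)).continuousWithinAt
  · fun_prop

theorem exp_log_abs_add_smul_one (T : H →L[ℂ] H) {ε : ℝ} (hε : 0 < ε) :
    NormedSpace.exp (CFC.log (CFC.abs (CFC.abs T + (ε : ℂ) • (1 : H →L[ℂ] H)))) =
      CFC.abs T + (ε : ℂ) • (1 : H →L[ℂ] H) := by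
  rw [log_abs_add_smul_one T hε, abs_add_smul_one_eq_cfc,
    ← CFC.real_exp_eq_normedSpace_exp (cfc_predicate _ _),
    ← cfc_comp' Real.exp _ (star T * T) (by fun_prop) (continuous_log_sqrt_add hε).continuousOn]
  exact cfc_congr fun x _ => Real.exp_log (by positivity)

theorem apply_eq_zero_of_inner_eq_zero {A : H →L[ℂ] H} (hA : 0 ≤ A) {x : H}
    (h : inner ℂ x (A x) = 0) : A x = 0 := by
  obtain ⟨B, rfl⟩ := CStarAlgebra.nonneg_iff_eq_star_mul_self.1 hA
  have h1 : inner ℂ (B x) (B x) = 0 := by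
    rw [← h, ← ContinuousLinearMap.adjoint_inner_right]
    rfl
  change (star B) (B x) = 0
  rw [inner_self_eq_zero.1 h1, map_zero]

end FunctionalCalculus

/-! ### Trace inequalities for a tracial vector state on a von Neumann algebra. -/

section VectorState

variable {H : Type*} [NormedAddCommGroup H] [InnerProductSpace ℂ H]

/-- The vector state `T ↦ (T e, e)`. -/
def vectorState (e : H) : (H →L[ℂ] H) →L[ℂ] ℂ :=
  innerSL ℂ e ∘L ContinuousLinearMap.apply ℂ H e

theorem vectorState_apply (e : H) (A : H →L[ℂ] H) : vectorState e A = inner ℂ e (A e) := rfl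

theorem vectorState_one {e : H} (he : ‖e‖ = 1) : vectorState e 1 = 1 := by
  change inner ℂ e e = _
  rw [inner_self_eq_norm_sq_to_K, he]
  simp

theorem vectorState_real_smul (e : H) (s : ℝ) (A : H →L[ℂ] H) :
    vectorState e (s • A) = s * vectorState e A := by
  rw [← Complex.coe_smul, map_smul, smul_eq_mul]

variable [CompleteSpace H] {M : VonNeumannAlgebra H}

/-- By the double commutant property, closure of `M` under `exp` and functional calculus becomes a
statement about commuting operators. -/
theorem mem_iff_commute {A : H →L[ℂ] H} : A ∈ M ↔ ∀ B ∈ M.commutant, Commute B A := by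
  conv_lhs => rw [← VonNeumannAlgebra.commutant_commutant M]
  rw [VonNeumannAlgebra.mem_commutant_iff]
  rfl

theorem exp_mem {A : H →L[ℂ] H} (hA : A ∈ M) : NormedSpace.exp A ∈ M := by
  rw [mem_iff_commute] at *
  exact fun B hB => (hA B hB).exp_right

theorem cfc_mem {A : H →L[ℂ] H} (hA : A ∈ M) (f : ℝ → ℝ) : cfc f A ∈ M := by
  rw [mem_iff_commute] at *
  exact fun B hB => ((hA B hB).symm.cfc_real f).symm

theorem real_smul_mem {A : H →L[ℂ] H} (hA : A ∈ M) (t : ℝ) : t • A ∈ M := by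
  rw [mem_iff_commute] at *
  exact fun B hB => (hA B hB).smul_right t

theorem vectorState_star (e : H) (A : H →L[ℂ] H) :
    vectorState e (star A) = (starRingEnd ℂ) (vectorState e A) := by
  rw [vectorState_apply, vectorState_apply, inner_conj_symm,
    ContinuousLinearMap.star_eq_adjoint, ContinuousLinearMap.adjoint_inner_right]

theorem vectorState_star_mul_self_re_nonneg (e : H) (A : H →L[ℂ] H) :
    0 ≤ (vectorState e (star A * A)).re := by
  change 0 ≤ (inner ℂ e ((star A) (A e))).re
  rw [ContinuousLinearMap.star_eq_adjoint, ContinuousLinearMap.adjoint_inner_right]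
  exact inner_self_nonneg (𝕜 := ℂ)

/-- Expand `τ((AB - 1)*(AB - 1)) ≥ 0`: the cross terms have equal real parts, and traciality turns
`τ(BA²B)` into `τ(A²B²)`. -/
theorem two_mul_trace_mul_sub_one_le {e : H} (he : ‖e‖ = 1)
    (htr : ∀ {A B : H →L[ℂ] H}, A ∈ M → B ∈ M → vectorState e (A * B) = vectorState e (B * A))
    {A B : H →L[ℂ] H} (hA : A ∈ M)
    (hB : B ∈ M) (hA' : IsSelfAdjoint A) (hB' : IsSelfAdjoint B) :
    2 * ((vectorState e (A * B)).re - 1) ≤ (vectorState e (A * A * (B * B))).re - 1 := by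
  have h := vectorState_star_mul_self_re_nonneg e (A * B - 1)
  have e1 : star (A * B - 1) * (A * B - 1) = B * (A * A * B) - star (A * B) - A * B + 1 := by
    rw [star_sub, star_mul, hA'.star_eq, hB'.star_eq, star_one]
    noncomm_ring
  have e2 : vectorState e (B * (A * A * B)) = vectorState e (A * A * (B * B)) := by
    rw [htr hB (mul_mem (mul_mem hA hA) hB), mul_assoc (A * A)]
  rw [e1, map_add, map_sub, map_sub] at h
  simp only [e2, vectorState_star, vectorState_one he, Complex.add_re, Complex.sub_re,
    Complex.conj_re, Complex.one_re] at h
  linarith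

theorem hasDerivAt_trace_exp_mul_exp (e : H) (X Y : H →L[ℂ] H) :
    HasDerivAt (fun t : ℝ => (vectorState e (NormedSpace.exp (t • X) * NormedSpace.exp (t • Y))).re)
      ((vectorState e X).re + (vectorState e Y).re) 0 := by
  have h := (hasDerivAt_exp_smul_const (𝕂 := ℝ) X 0).mul (hasDerivAt_exp_smul_const (𝕂 := ℝ) Y 0)
  have h2 := (Complex.reCLM.comp
    ((vectorState e).restrictScalars ℝ)).hasFDerivAt.comp_hasDerivAt (0 : ℝ) h
  have e2 : (Complex.reCLM ∘SL (vectorState e).restrictScalars ℝ)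
      (NormedSpace.exp ((0 : ℝ) • X) * X * NormedSpace.exp ((0 : ℝ) • Y) +
        NormedSpace.exp ((0 : ℝ) • X) * (NormedSpace.exp ((0 : ℝ) • Y) * Y)) =
      (vectorState e X).re + (vectorState e Y).re := by
    simp
  exact e2 ▸ h2

/-- Doubling `t` squares both exponentials, so the previous estimate gives `2(g(t) - 1) ≤ g(2t) -
1`. Iteration bounds `g(1) - 1` below by the difference quotients of `g` at `0` along `t = 2⁻ⁿ`,
which tend to `g'(0)`. -/
theorem one_add_trace_le_trace_exp_mul_exp {e : H} (he : ‖e‖ = 1)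
    (htr : ∀ {A B : H →L[ℂ] H}, A ∈ M → B ∈ M → vectorState e (A * B) = vectorState e (B * A))
    {X Y : H →L[ℂ] H} (hX : X ∈ M)
    (hY : Y ∈ M) (hX' : IsSelfAdjoint X) (hY' : IsSelfAdjoint Y) :
    1 + (vectorState e X).re + (vectorState e Y).re ≤
      (vectorState e (NormedSpace.exp X * NormedSpace.exp Y)).re := by
  let _ : NormedAlgebra ℚ (H →L[ℂ] H) := NormedAlgebra.restrictScalars ℚ ℝ _
  set g : ℝ → ℝ := fun t =>
    (vectorState e (NormedSpace.exp (t • X) * NormedSpace.exp (t • Y))).re with hg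
  have hdouble (Z : H →L[ℂ] H) (t : ℝ) : NormedSpace.exp ((2 * t) • Z) =
      NormedSpace.exp (t • Z) * NormedSpace.exp (t • Z) := by
    rw [two_mul, add_smul]
    exact NormedSpace.exp_add_of_commute rfl
  have hsa {Z : H →L[ℂ] H} (hZ : IsSelfAdjoint Z) (t : ℝ) :
      IsSelfAdjoint (NormedSpace.exp (t • Z)) :=
    (IsSelfAdjoint.smul (IsSelfAdjoint.all t) hZ).exp
  have hstep (t : ℝ) : 2 * (g t - 1) ≤ g (2 * t) - 1 := by
    simp only [hg, hdouble]
    exact two_mul_trace_mul_sub_one_le he htr (exp_mem (real_smul_mem hX t))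
      (exp_mem (real_smul_mem hY t)) (hsa hX' t) (hsa hY' t)
  have hiter (n : ℕ) : 2 ^ n * (g ((2 ^ n)⁻¹) - 1) ≤ g 1 - 1 := by
    induction n with
    | zero => simp
    | succ n ih =>
      refine le_trans ?_ ih
      have h := hstep ((2 ^ (n + 1))⁻¹)
      have e : (2 : ℝ) * (2 ^ (n + 1))⁻¹ = (2 ^ n)⁻¹ := by
        rw [pow_succ]
        field_simp
      rw [e] at h
      rw [pow_succ (2 : ℝ) n, mul_assoc, ← pow_succ]
      exact mul_le_mul_of_nonneg_left h (by positivity)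
  have hg0 : g 0 = 1 := by simp [hg, vectorState_one he]
  have hpow : Filter.Tendsto (fun n : ℕ => ((2 : ℝ) ^ n)⁻¹) Filter.atTop (𝓝[≠] 0) := by
    refine tendsto_nhdsWithin_iff.2 ⟨?_, Filter.Eventually.of_forall fun n => by simp⟩
    exact tendsto_inv_atTop_zero.comp (tendsto_pow_atTop_atTop_of_one_lt one_lt_two)
  have hlim := (hasDerivAt_iff_tendsto_slope_zero.1
    (hasDerivAt_trace_exp_mul_exp e X Y)).comp hpow
  have h := le_of_tendsto' hlim (b := g 1 - 1) fun n => by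
    have := hiter n
    simpa [hg0, hg, vectorState_one he] using this
  simp only [hg, one_smul] at h
  linarith

theorem exp_trace_le_trace_exp_mul_exp {e : H} (he : ‖e‖ = 1)
    (htr : ∀ {A B : H →L[ℂ] H}, A ∈ M → B ∈ M → vectorState e (A * B) = vectorState e (B * A))
    {X Y : H →L[ℂ] H} (hX : X ∈ M)
    (hY : Y ∈ M) (hX' : IsSelfAdjoint X) (hY' : IsSelfAdjoint Y) :
    Real.exp ((vectorState e X).re + (vectorState e Y).re) ≤
      (vectorState e (NormedSpace.exp X * NormedSpace.exp Y)).re := by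
  let _ : NormedAlgebra ℚ (H →L[ℂ] H) := NormedAlgebra.restrictScalars ℚ ℝ _
  -- Replacing `Y` by `Y + c` makes the two traces sum to zero in real part, so the linear lower
  -- bound is exactly `1`; the factor `e^c` is then divided out.
  set c : ℝ := -((vectorState e X).re + (vectorState e Y).re) with hc
  have h1 : (1 : H →L[ℂ] H) ∈ M := one_mem _
  have h := one_add_trace_le_trace_exp_mul_exp he htr hX
    (add_mem hY (real_smul_mem h1 c)) hX'
    (hY'.add ((IsSelfAdjoint.all c).smul (IsSelfAdjoint.one _)))
  have e1 : NormedSpace.exp (c • (1 : H →L[ℂ] H)) = Real.exp c • (1 : H →L[ℂ] H) := by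
    rw [← Algebra.algebraMap_eq_smul_one, ← Algebra.algebraMap_eq_smul_one, Real.exp_eq_exp_ℝ]
    exact (NormedSpace.algebraMap_exp_comm c).symm
  have e2 : NormedSpace.exp (Y + c • (1 : H →L[ℂ] H)) = Real.exp c • NormedSpace.exp Y := by
    rw [NormedSpace.exp_add_of_commute ((Commute.one_right Y).smul_right c), e1, mul_smul_comm,
      mul_one]
  rw [e2, mul_smul_comm, vectorState_real_smul, map_add, vectorState_real_smul,
    vectorState_one he, mul_one, Complex.re_ofReal_mul, Complex.add_re, Complex.ofReal_re] at h
  have h5 : 1 ≤ Real.exp c * (vectorState e (NormedSpace.exp X * NormedSpace.exp Y)).re := by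
    refine le_trans (le_of_eq ?_) h
    rw [hc]
    ring
  calc Real.exp ((vectorState e X).re + (vectorState e Y).re) = (Real.exp c)⁻¹ * 1 := by
        rw [← Real.exp_neg, hc, neg_neg, mul_one]
    _ ≤ (Real.exp c)⁻¹ *
        (Real.exp c * (vectorState e (NormedSpace.exp X * NormedSpace.exp Y)).re) := by
        gcongr
    _ = _ := inv_mul_cancel_left₀ (Real.exp_ne_zero c) _

/-! ### Equality of the determinants of `T` and `T*`. -/

theorem trace_aeval_star_mul_self {e : H}
    (htr : ∀ {A B : H →L[ℂ] H}, A ∈ M → B ∈ M → vectorState e (A * B) = vectorState e (B * A))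
    {T : H →L[ℂ] H} (hT : T ∈ M) (p : Polynomial ℝ) :
    vectorState e (Polynomial.aeval (star T * T) p) =
      vectorState e (Polynomial.aeval (T * star T) p) := by
  have hT' : star T ∈ M := star_mem hT
  have hpow (n : ℕ) : vectorState e ((star T * T) ^ n) = vectorState e ((T * star T) ^ n) := by
    cases n with
    | zero => simp
    | succ n =>
      have e : (star T * T) ^ (n + 1) = star T * ((T * star T) ^ n * T) := by
        induction n with
        | zero => simp
        | succ n ih => rw [pow_succ', ih, pow_succ' (T * star T)]; noncomm_ring
      rw [e, htr hT' (mul_mem (pow_mem (mul_mem hT hT') n) hT), mul_assoc, pow_succ]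
  rw [Polynomial.aeval_eq_sum_range, Polynomial.aeval_eq_sum_range, map_sum, map_sum]
  refine Finset.sum_congr rfl fun n _ => ?_
  rw [vectorState_real_smul, vectorState_real_smul, hpow]

/-- Traciality gives the case of polynomials; Weierstrass approximation on `[0, ‖T‖²]`, which
contains both spectra, gives the rest. -/
theorem trace_cfc_star_mul_self {e : H}
    (htr : ∀ {A B : H →L[ℂ] H}, A ∈ M → B ∈ M → vectorState e (A * B) = vectorState e (B * A))
    {T : H →L[ℂ] H} (hT : T ∈ M) {f : ℝ → ℝ}
    (hf : Continuous f) :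
    vectorState e (cfc f (star T * T)) = vectorState e (cfc f (T * star T)) := by
  have happrox {a : H →L[ℂ] H} (ha : 0 ≤ a) (hn : ‖a‖ ≤ ‖T‖ * ‖T‖) {p : Polynomial ℝ} {η : ℝ}
      (hη : 0 ≤ η) (hp : ∀ x ∈ Set.Icc 0 (‖T‖ * ‖T‖), |p.eval x - f x| < η) :
      ‖vectorState e (Polynomial.aeval a p) - vectorState e (cfc f a)‖ ≤ ‖vectorState e‖ * η := by
    rw [← map_sub, ← cfc_polynomial p a ha.isSelfAdjoint,
      ← cfc_sub _ _ a]
    refine ((vectorState e).le_opNorm _).trans ?_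
    gcongr
    refine norm_cfc_le hη fun x hx => (hp x ⟨spectrum_nonneg_of_nonneg ha hx, ?_⟩).le
    exact (Real.le_norm_self x).trans ((spectrum.norm_le_norm_mul_of_mem hx).trans
      ((mul_le_of_le_one_right (norm_nonneg a) ContinuousLinearMap.norm_id_le).trans hn))
  refine eq_of_sub_eq_zero (norm_le_zero_iff.1 (le_of_forall_pos_le_add fun η hη => ?_))
  set K : ℝ := ‖vectorState e‖ with hK
  have hK0 : 0 ≤ K := norm_nonneg (vectorState e)
  -- Two errors of at most `K` times this tolerance must add up to at most `η`; `K + 1` avoids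
  -- dividing by zero.
  obtain ⟨p, hp⟩ := exists_polynomial_near_of_continuousOn 0 (‖T‖ * ‖T‖) f hf.continuousOn
    (η / (2 * (K + 1))) (by positivity)
  have h1 := happrox (star_mul_self_nonneg T) (CStarRing.norm_star_mul_self).le
    (by positivity) hp
  have h2 := happrox (mul_star_self_nonneg T) (CStarRing.norm_self_mul_star).le
    (by positivity) hp
  rw [trace_aeval_star_mul_self htr hT] at h1
  have h3 : K * (η / (2 * (K + 1))) ≤ η / 2 := by
    rw [← mul_div_assoc, div_le_div_iff₀ (by positivity) two_pos]
    nlinarith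
  calc _ = ‖(vectorState e (Polynomial.aeval (T * star T) p) - vectorState e (cfc f (T * star T))) -
        (vectorState e (Polynomial.aeval (T * star T) p) - vectorState e (cfc f (star T * T)))‖ := by
        congr 1; ring
    _ ≤ _ := norm_sub_le _ _
    _ ≤ 0 + η := by linarith

theorem fkDetOf_star {e : H}
    (htr : ∀ {A B : H →L[ℂ] H}, A ∈ M → B ∈ M → vectorState e (A * B) = vectorState e (B * A))
    {T : H →L[ℂ] H} (hT : T ∈ M) :
    fkDetOf (fun T => inner ℂ e (T e)) (star T) = fkDetOf (fun T => inner ℂ e (T e)) T := by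
  refine tendsto_nhds_unique (tendsto_fkDetOf e (star T)) ?_
  refine (tendsto_fkDetOf e T).congr' ?_
  filter_upwards [self_mem_nhdsWithin] with ε hε
  simp only [fkDetUnit]
  rw [log_abs_add_smul_one _ hε, log_abs_add_smul_one _ hε, star_star]
  exact congrArg (fun z : ℂ => Real.exp z.re)
    (trace_cfc_star_mul_self htr hT (continuous_log_sqrt_add hε))

theorem log_abs_add_smul_one_mem {T : H →L[ℂ] H} (hT : T ∈ M) {ε : ℝ} (hε : 0 < ε) :
    CFC.log (CFC.abs (CFC.abs T + (ε : ℂ) • (1 : H →L[ℂ] H))) ∈ M := by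
  rw [log_abs_add_smul_one T hε]
  exact cfc_mem (mul_mem (star_mem hT) hT) _

/-! ### The determinant inequality. -/

theorem fkDetOf_mul_fkDetOf_sq_le {e : H} (he : ‖e‖ = 1)
    (htr : ∀ {A B : H →L[ℂ] H}, A ∈ M → B ∈ M → vectorState e (A * B) = vectorState e (B * A))
    {A T : H →L[ℂ] H} (hA : A ∈ M) (hpos : 0 ≤ A)
    (hT : T ∈ M) :
    fkDetOf (fun T => inner ℂ e (T e)) A * fkDetOf (fun T => inner ℂ e (T e)) T ^ 2 ≤
      (vectorState e (star T * A * T)).re := by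
  let _ : NormedAlgebra ℚ (H →L[ℂ] H) := NormedAlgebra.restrictScalars ℚ ℝ _
  have hT' : star T ∈ M := star_mem hT
  -- Cycling the trace produces `TT* = |T*|²`, so the determinant needed is that of `T*`.
  rw [← fkDetOf_star htr hT, mul_assoc, htr hT' (mul_mem hA hT), mul_assoc]
  have hlim : Filter.Tendsto (fun ε : ℝ => (vectorState e ((CFC.abs A + (ε : ℂ) • (1 : H →L[ℂ] H)) *
      ((CFC.abs (star T) + (ε : ℂ) • (1 : H →L[ℂ] H)) *
        (CFC.abs (star T) + (ε : ℂ) • (1 : H →L[ℂ] H))))).re) (𝓝[>] 0)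
      (𝓝 (vectorState e (A * (T * star T))).re) := by
    have hc : Continuous (fun ε : ℝ => (vectorState e ((CFC.abs A + (ε : ℂ) • (1 : H →L[ℂ] H)) *
      ((CFC.abs (star T) + (ε : ℂ) • (1 : H →L[ℂ] H)) *
        (CFC.abs (star T) + (ε : ℂ) • (1 : H →L[ℂ] H))))).re) := by fun_prop
    have h := (hc.tendsto 0).mono_left (nhdsWithin_le_nhds (s := Set.Ioi 0))
    simpa [ CFC.abs_of_nonneg A hpos, CFC.abs_mul_abs] using h
  refine le_of_tendsto_of_tendsto ((tendsto_fkDetOf e A).mul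
    ((tendsto_fkDetOf e (star T)).pow 2)) hlim ?_
  filter_upwards [self_mem_nhdsWithin] with ε hε
  have hX := log_abs_add_smul_one_mem hA hε
  have hY := log_abs_add_smul_one_mem hT' hε
  -- The second logarithm is taken twice to account for the square of the determinant.
  have h := exp_trace_le_trace_exp_mul_exp he htr hX (add_mem hY hY) IsSelfAdjoint.log
    (IsSelfAdjoint.log.add IsSelfAdjoint.log)
  rw [NormedSpace.exp_add_of_commute (Commute.refl _), exp_log_abs_add_smul_one _ hε,
    exp_log_abs_add_smul_one _ hε] at h
  refine le_trans (le_of_eq ?_) h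
  simp only [fkDetUnit]
  rw [← Real.exp_nat_mul, ← Real.exp_add, map_add, Complex.add_re]
  congr 1
  simp only [vectorState_apply]
  push_cast
  ring

end VectorState

end GroupVN

end

noncomputable section

namespace GroupVN

/-! ### The trace of the group von Neumann algebra. -/

section GroupTrace

variable {Γ : Type*}

theorem norm_vec (γ : Γ) : ‖vec γ‖ = 1 := by
  have h1 : inner ℂ (vec γ) (vec γ) = (1 : ℂ) := by
    rw [inner_vec]
    simp [vec, MonoidAlgebra.coeff_single]
  rw [norm_eq_sqrt_re_inner (𝕜 := ℂ), h1]
  simp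

variable [Group Γ]

/-- Commuting with left translations moves `γ` from one argument of the scalar product to the other
as `γ⁻¹`. -/
theorem star_apply_vec_one {A : BddOp Γ} (hA : A ∈ vonNeumann Γ) (γ : Γ) :
    (star A) (vec 1) γ = (starRingEnd ℂ) (A (vec 1) γ⁻¹) := by
  have hv : vec γ = leftMul γ (vec 1) := by rw [leftMul_vec, mul_one]
  rw [← inner_vec, ContinuousLinearMap.star_eq_adjoint,
    ContinuousLinearMap.adjoint_inner_right, hv, mem_vonNeumann_iff.1 hA, ← inner_conj_symm,
    inner_vec, leftMul_apply, mul_one]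

theorem trace_mul_eq_tsum {A : BddOp Γ} (hA : A ∈ vonNeumann Γ) (B : BddOp Γ) :
    trace (A * B) = ∑' γ : Γ, A (vec 1) γ⁻¹ * B (vec 1) γ := by
  change inner ℂ (vec 1) (A (B (vec 1))) = _
  rw [← ContinuousLinearMap.adjoint_inner_left, ← ContinuousLinearMap.star_eq_adjoint,
    lp.inner_eq_tsum]
  refine tsum_congr fun γ => ?_
  rw [star_apply_vec_one hA]
  simp [mul_comm]

/-- The substitution `γ ↦ γ⁻¹` exchanges the roles of `A` and `B` in the sum for the trace. -/
theorem trace_mul_comm {A B : BddOp Γ} (hA : A ∈ vonNeumann Γ) (hB : B ∈ vonNeumann Γ) :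
    trace (A * B) = trace (B * A) := by
  rw [trace_mul_eq_tsum hA, trace_mul_eq_tsum hB, ← (Equiv.inv Γ).tsum_eq]
  exact tsum_congr fun γ => by simp [mul_comm]

theorem fkDet_mul_fkDet_sq_le {A T : BddOp Γ} (hA : A ∈ vonNeumann Γ) (hpos : 0 ≤ A)
    (hT : T ∈ vonNeumann Γ) :
    fkDet A * fkDet T ^ 2 ≤ (inner ℂ (T (vec 1)) (A (T (vec 1)))).re := by
  have h := fkDetOf_mul_fkDetOf_sq_le (norm_vec (1 : Γ)) trace_mul_comm hA hpos hT
  rw [← ContinuousLinearMap.adjoint_inner_right]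
  exact h

/-- The inverse in `f̃` cancels the one in `r`: `r(f̃) = ∑ f_γ R_γ`, and `R_γ e = γ`. -/
theorem rightReg_tilde_vec_one (f : MonoidAlgebra ℂ Γ) :
    rightReg (tilde f) (vec 1) = toL2 f := by
  induction f using MonoidAlgebra.induction_linear with
  | zero => simp [tilde]
  | add f g hf hg =>
    rw [tilde] at *
    rw [MonoidAlgebra.mapDomain_add, map_add, map_add, ← hf, ← hg]
    rfl
  | single γ c =>
    rw [tilde, MonoidAlgebra.mapDomain_single, rightReg_single, inv_inv]
    change c • rightMul γ (vec 1) = _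
    rw [rightMul_vec, one_mul, vec, ← map_smul, MonoidAlgebra.smul_single, smul_eq_mul, mul_one]

end GroupTrace

/-! ### Compressions to finite subsets and the Schur complement. -/

section Compression

variable {Γ : Type*}

theorem inclL2_eq_sum (F : Finset Γ) (v : EuclideanSpace ℂ F) :
    inclL2 F v = ∑ δ : F, v δ • vec (δ : Γ) := by
  change toL2 (∑ δ : F, MonoidAlgebra.single (δ : Γ) (v δ)) = _
  rw [map_sum]
  refine Finset.sum_congr rfl fun δ _ => ?_
  rw [vec, ← map_smul, MonoidAlgebra.smul_single, smul_eq_mul, mul_one]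

/-- The matrix of `A_F` with respect to the basis `F` of `ℂF`. -/
def compressMatrix (A : BddOp Γ) (F : Finset Γ) : Matrix F F ℂ :=
  Matrix.of fun δ ε => A (vec (ε : Γ)) (δ : Γ)

theorem compress_apply (A : BddOp Γ) (F : Finset Γ) (v : EuclideanSpace ℂ F) (δ : F) :
    compress A F v δ = A (inclL2 F v) (δ : Γ) :=
  proj_apply F _ δ

theorem apply_inclL2 (A : BddOp Γ) (F : Finset Γ) (v : EuclideanSpace ℂ F) (γ : Γ) :
    A (inclL2 F v) γ = ∑ ε : F, A (vec (ε : Γ)) γ * v ε := by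
  rw [← inner_vec, inclL2_eq_sum, map_sum, inner_sum]
  refine Finset.sum_congr rfl fun ε _ => ?_
  rw [map_smul, inner_smul_right, inner_vec, mul_comm]

theorem compressMatrix_mulVec (A : BddOp Γ) (F : Finset Γ) (v : EuclideanSpace ℂ F) :
    (compressMatrix A F).mulVec v.ofLp = (compress A F v).ofLp := by
  ext δ
  exact ((compress_apply A F v δ).trans (apply_inclL2 A F v δ)).symm

theorem det_compress [DecidableEq Γ] (A : BddOp Γ) (F : Finset Γ) :
    (compress A F).det = (compressMatrix A F).det := by
  rw [ContinuousLinearMap.det,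
    ← LinearMap.det_toMatrix (EuclideanSpace.basisFun F ℂ).toBasis]
  congr 1
  ext δ ε
  rw [LinearMap.toMatrix_apply]
  simp [compressMatrix, compress_apply, inclL2_single]

/-- For positive `A`, `(Au, u) = 0` forces `Au = 0`, which injectivity on `ℂΓ` excludes for `u ≠ 0`.
-/
theorem inner_compress_pos {A : BddOp Γ} (hpos : A.IsPositive)
    (hinj : Set.InjOn A (Set.range (toL2 : MonoidAlgebra ℂ Γ → L2 Γ)))
    (F : Finset Γ) {v : EuclideanSpace ℂ F} (hv : v ≠ 0) :
    0 < inner ℂ v (compress A F v) := by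
  have h1 : inner ℂ v (compress A F v) = inner ℂ (inclL2 F v) (A (inclL2 F v)) :=
    ContinuousLinearMap.adjoint_inner_right (inclL2 F) v (A (inclL2 F v))
  rw [h1]
  refine lt_of_le_of_ne (hpos.inner_nonneg_right _) fun h => hv ?_
  have h2 := apply_eq_zero_of_inner_eq_zero
    ((ContinuousLinearMap.nonneg_iff_isPositive A).2 hpos) h.symm
  have h3 : inclL2 F v = 0 :=
    hinj ⟨incl F v, rfl⟩ ⟨0, map_zero _⟩ (h2.trans (map_zero A).symm)
  ext δ
  rw [← inclL2_apply, h3]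
  rfl

theorem posDef_compressMatrix {A : BddOp Γ} (hpos : A.IsPositive)
    (hinj : Set.InjOn A (Set.range (toL2 : MonoidAlgebra ℂ Γ → L2 Γ)))
    (F : Finset Γ) : (compressMatrix A F).PosDef := by
  refine Matrix.PosDef.of_dotProduct_mulVec_pos ?_ fun x hx => ?_
  · ext δ ε
    simp only [compressMatrix, Matrix.conjTranspose_apply, Matrix.of_apply]
    rw [← inner_vec, ← inner_vec, RCLike.star_def, inner_conj_symm,
      ← ContinuousLinearMap.adjoint_inner_right, hpos.isSelfAdjoint.adjoint_eq]
  · have h := inner_compress_pos hpos hinj F (v := WithLp.toLp 2 x) (by simpa using hx)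
    rwa [EuclideanSpace.inner_eq_star_dotProduct, ← compressMatrix_mulVec, dotProduct_comm] at h

theorem isUnit_compress {A : BddOp Γ} (hpos : A.IsPositive)
    (hinj : Set.InjOn A (Set.range (toL2 : MonoidAlgebra ℂ Γ → L2 Γ)))
    (F : Finset Γ) : IsUnit (compress A F) := by
  have h : Function.Injective (compress A F : EuclideanSpace ℂ F →ₗ[ℂ] EuclideanSpace ℂ F) := by
    refine (injective_iff_map_eq_zero _).2 fun v hv => by_contra fun hv0 => ?_
    have h1 := inner_compress_pos hpos hinj F hv0
    rw [show compress A F v = 0 from hv, inner_zero_right] at h1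
    exact lt_irrefl _ h1
  exact ContinuousLinearMap.isUnit_iff_bijective.2 ⟨h, LinearMap.injective_iff_surjective.1 h⟩

/-- In block form with `γ` last, the determinant is `det A_F` times the Schur complement of `A_F`,
and that scalar is `(AΦ, Φ)`. -/
theorem det_compress_cons {A : BddOp Γ} (hpos : A.IsPositive)
    (hinj : Set.InjOn A (Set.range (toL2 : MonoidAlgebra ℂ Γ → L2 Γ)))
    (F : Finset Γ) (γ : Γ) (hγ : γ ∉ F) :
    (compress A (F.cons γ hγ)).det = (compress A F).det *
      inner ℂ (toL2 (orthResidual A F γ)) (A (toL2 (orthResidual A F γ))) := by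
  classical
  have hunit := isUnit_compress hpos hinj F
  set w : EuclideanSpace ℂ F := Ring.inverse (compress A F) (proj F (A (vec γ))) with hw
  have hΦ : toL2 (orthResidual A F γ) = vec γ - inclL2 F w := by
    rw [orthResidual, map_sub]
    rfl
  have hCw : compress A F w = proj F (A (vec γ)) :=
    congrArg (fun T : EuclideanSpace ℂ F →L[ℂ] EuclideanSpace ℂ F => T (proj F (A (vec γ))))
      (Ring.mul_inverse_cancel _ hunit)
  have hschur : inner ℂ (toL2 (orthResidual A F γ)) (A (toL2 (orthResidual A F γ))) =
      A (vec γ) γ - A (inclL2 F w) γ := by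
    -- Since `Φ` is `A`-orthogonal to `ℂF`, one of its two occurrences may be replaced by `γ`.
    set Φ := toL2 (orthResidual A F γ)
    calc inner ℂ Φ (A Φ) = inner ℂ (vec γ - inclL2 F w) (A Φ) := by rw [← hΦ]
      _ = inner ℂ (vec γ) (A Φ) := by
        rw [inner_sub_left, orthResidual_orthogonal A F γ hunit, sub_zero]
      _ = _ := by rw [hΦ, map_sub, inner_sub_right, inner_vec, inner_vec]
  let e : F ⊕ Unit ≃ F.cons γ hγ := Equiv.ofBijective
    (Sum.elim (fun δ => ⟨δ, Finset.mem_cons_of_mem δ.2⟩)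
      fun _ => ⟨γ, Finset.mem_cons_self γ F⟩) <| by
    constructor
    · rintro (⟨a, ha⟩ | _) (⟨b, hb⟩ | _) h <;> simp only [Sum.elim_inl, Sum.elim_inr,
        Subtype.mk.injEq] at h
      · subst h; rfl
      · exact absurd (h ▸ ha) hγ
      · exact absurd (h ▸ hb) hγ
      · rfl
    · rintro ⟨a, ha⟩
      rcases Finset.mem_cons.1 ha with rfl | h
      · exact ⟨Sum.inr (), rfl⟩
      · exact ⟨Sum.inl ⟨a, h⟩, rfl⟩
  let W : Matrix F Unit ℂ := Matrix.of fun δ _ => w δ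
  let R : Matrix Unit F ℂ := Matrix.of fun _ ε => A (vec (ε : Γ)) γ
  -- The upper right column `p_F A γ` is written as `A_F w`, so that the inverse of `A_F` cancels in
  -- the Schur complement.
  have hblock : (compressMatrix A (F.cons γ hγ)).submatrix e e =
      Matrix.fromBlocks (compressMatrix A F) (compressMatrix A F * W) R
        (Matrix.of fun _ _ => A (vec γ) γ) := by
    ext (i | i) (j | j)
    · rfl
    · have h := congrFun (compressMatrix_mulVec A F w) i
      rw [hCw] at h
      exact ((h.trans (proj_apply F _ i))).symm
    · rfl
    · rfl
  rw [det_compress, det_compress, ← Matrix.det_submatrix_equiv_self e, hblock, hschur]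
  have hM : IsUnit (compressMatrix A F).det :=
    (posDef_compressMatrix hpos hinj F).det_pos.ne'.isUnit
  let _ := Matrix.invertibleOfIsUnitDet _ hM
  rw [Matrix.det_fromBlocks₁₁, Matrix.mul_assoc, Matrix.invOf_mul_cancel_left,
    Matrix.det_unique (n := Unit)]
  congr 1
  rw [apply_inclL2]
  rfl

end Compression

end GroupVN

end

open GroupVN
theorem corollary12 {Γ : Type*} [Group Γ] [Countable Γ] (A : BddOp Γ)
    (hA : A ∈ vonNeumann Γ) (hpos : A.IsPositive)
    (hinj : Set.InjOn A (Set.range (toL2 : MonoidAlgebra ℂ Γ → L2 Γ)))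
    (F F' : Finset Γ) (γ : Γ) (hγ : γ ∉ F) (hF' : F' = F.cons γ hγ) :
    0 < (compress A F).det ∧
      ((fkDet A * fkDet (rightReg (tilde (orthResidual A F γ))) ^ 2 : ℝ) : ℂ) ≤
        (compress A F').det / (compress A F).det := by
  classical
  have hdet : 0 < (compress A F).det := by
    rw [det_compress]
    exact (posDef_compressMatrix hpos hinj F).det_pos
  refine ⟨hdet, ?_⟩
  have h := fkDet_mul_fkDet_sq_le hA ((ContinuousLinearMap.nonneg_iff_isPositive A).2 hpos)
    (rightReg_mem (tilde (orthResidual A F γ)))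
  rw [rightReg_tilde_vec_one] at h
  rw [hF', det_compress_cons hpos hinj F γ hγ, mul_div_cancel_left₀ _ hdet.ne']
  have hn := hpos.inner_nonneg_right (toL2 (orthResidual A F γ))
  -- The order on `ℂ` also requires equal imaginary parts; that of `(AΦ, Φ)` vanishes because `A` is
  -- positive.
  rw [Complex.le_def]
  exact ⟨h, (Complex.le_def.1 hn).2⟩
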